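/- **Setting.** Scalars are real or complex, $X^*$ is the conjugate transpose. Fix integers $L\ge 1$, $n,k\ge 0$ and put $N=n2^L$. The index set $\{1,\dots,N\}$ is partitioned by a fully populated binary tree with levels $0,\dots,L$: level $\ell$ has $2^\ell$ boxes, each box on a level $\ell<L$ has two children on level $\ell+1$, and each leaf $\tau$ (a box on level $L$) carries an index vector $I_\tau$ of $n$ indices. An $N\times N$ matrix $A$ is *hierarchically block separable (HBS) with block rank $k$* if there are $k\times k$ matrices $\tilde A_{\tau,\tau'}$, for all pairs of distinct boxes $\tau\ne\tau'$ on the same level $\ell\in\{1,\dots,L\}$, and matrices $U_\tau,V_\tau$, of size $n\times k$ for leaves and $2k\times k$ for the boxes on the levels $1,\dots,L-1$, such that - $A(I_\tau,I_{\tau'})=U_\tau\tilde A_{\tau,\tau'}V_{\tau'}^*$ for distinct leaves $\tau,\tau'$; - $\begin{bmatrix}\tilde A_{\sigma_1,\sigma_1'}&\tilde A_{\sigma_1,\sigma_2'}\\ \tilde A_{\sigma_2,\sigma_1'}&\tilde A_{\sigma_2,\sigma_2'}\end{bmatrix}=U_\tau\tilde A_{\tau,\tau'}V_{\tau'}^*$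 for distinct boxes $\tau,\tau'$ on a level $\ell\in\{1,\dots,L-1\}$, with children $\sigma_1,\sigma_2$ and $\sigma_1',\sigma_2'$. Its *HBS factors* are the matrices $U_\tau,V_\tau$, the blocks $D_\tau=A(I_\tau,I_\tau)$ for the leaves, and $\tilde A_{\sigma_1,\sigma_2},\tilde A_{\sigma_2,\sigma_1}$ for each pair of siblings $\sigma_1,\sigma_2$. **Inversion algorithm** (input: HBS factors). For $\ell=L,L-1,\dots,1$ and every box $\tau$ on level $\ell$, set $\tilde D_\tau=D_\tau$ if $\tau$ is a leaf and $\tilde D_\tau=\begin{bmatrix}\hat D_{\sigma_1}&\tilde A_{\sigma_1,\sigma_2}\\ \tilde A_{\sigma_2,\sigma_1}&\hat D_{\sigma_2}\end{bmatrix}$ if $\tau$ has children $\sigma_1,\sigma_2$, and compute $$\hat D_\tau=(V_\tau^*\tilde D_\tau^{-1}U_\tau)^{-1},\quad E_\tau=\tilde D_\tau^{-1}U_\tau\hat D_\tau,\quad F_\tau^*=\hat D_\tau V_\tau^*\tilde D_\tau^{-1},\quad G_\tau=\tilde D_\tau^{-1}-\tilde D_\tau^{-1}U_\tau\hat D_\tau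 V_\tau^*\tilde D_\tau^{-1}.$$ Finally compute $G_1=\begin{bmatrix}\hat D_{2}&\tilde A_{2,3}\\ \tilde A_{3,2}&\hat D_{3}\end{bmatrix}^{-1}$, where $2,3$ are the children of the root. Dense matrices are inverted by Gaussian elimination with pivoting. The output consists of all $E_\tau,F_\tau^*,G_\tau$ and $G_1$. **Application algorithm** (input: this output and a vector $u$). Upward: $\hat u_\tau=F_\tau^*u(I_\tau)$ for leaves, then $\hat u_\tau=F_\tau^*\begin{bmatrix}\hat u_{\sigma_1}\\ \hat u_{\sigma_2}\end{bmatrix}$ for the boxes with children $\sigma_1,\sigma_2$ on the levels $L-1,\dots,1$. At the root: $\begin{bmatrix}\hat q_2\\ \hat q_3\end{bmatrix}=G_1\begin{bmatrix}\hat u_2\\ \hat u_3\end{bmatrix}$. Downward: $\begin{bmatrix}\hat q_{\sigma_1}\\ \hat q_{\sigma_2}\end{bmatrix}=E_\tau\hat q_\tau+G_\tau\begin{bmatrix}\hat u_{\sigma_1}\\ \hat u_{\sigma_2}\end{bmatrix}$ on the levels $1,\dots,L-1$, and finally $q(I_\tau)=E_\tau\hat q_\tau+G_\tau u(I_\tau)$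 for leaves. The output is $q$. An *operation* is an addition, subtraction, multiplication, reciprocal, complex conjugation or test for zero of scalars, in exact arithmetic. **Theorem.** There is an absolute constant $C$ with the following property. Let $n\le 2k$, let $A$ be an invertible $N\times N$ HBS matrix with block rank $k$, with given HBS factors, and assume that none of the matrices that the inversion algorithm has to invert is singular, that is, $\tilde D_\tau$ and $V_\tau^*\tilde D_\tau^{-1}U_\tau$ for all boxes $\tau$ on the levels $1,\dots,L$, and the $2k\times 2k$ matrix whose inverse is $G_1$. Then: 1. The inversion algorithm uses at most $C\,N k^2$ operations, and its output consists of at most $C\,N k$ scalars. 2. The output is an exact representation of $A^{-1}$: let $\underline E^{(\ell)},\underline F^{(\ell)},\underline G^{(\ell)}$ be the block diagonal matrices with the blocks $E_\tau,F_\tau,G_\tau$ of the boxes on level $\ell$; set $S^{(0)}=G_1$ and $S^{(\ell)}=\underline E^{(\ell)}S^{(\ell-1)}(\underline F^{(\ell)})^*+\underline G^{(\ell)}$ for $\ell=1,\dots,L$. Then $S^{(L)}=A^{-1}$ (with rows and columns ordered by the leaves). 3. For every vector $u$, the application algorithm returns exactly $A^{-1}u$, and it uses at most $C\,N k$ operations.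 -/

import Mathlib

/-! ## Counting scalar operations -/

/-- The result `val` of a computation, together with the number `cost` of elementary scalar
operations that were executed to obtain it. -/
structure Counted (α : Type) where
  val : α
  cost : ℕ

namespace Counted

instance : Monad Counted where
  pure a := ⟨a, 0⟩
  bind x f := ⟨(f x.val).val, x.cost + (f x.val).cost⟩

section Scalar

variable {𝕜 : Type} [Field 𝕜] [StarRing 𝕜] [DecidableEq 𝕜]

/-! The elementary operations. Each of them costs one; moving or copying numbers is free. -/

def add (x y : 𝕜) : Counted 𝕜 := ⟨x + y, 1⟩

def sub (x y : 𝕜) : Counted 𝕜 := ⟨x - y, 1⟩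

def mul (x y : 𝕜) : Counted 𝕜 := ⟨x * y, 1⟩

def recip (x : 𝕜) : Counted 𝕜 := ⟨x⁻¹, 1⟩

/-- Complex conjugation. -/
def conj (x : 𝕜) : Counted 𝕜 := ⟨star x, 1⟩

def isZero (x : 𝕜) : Counted Bool := ⟨decide (x = 0), 1⟩

end Scalar

/-- The loop "for all `i`, execute `f i`". -/
def forAll {ι α : Type} [Fintype ι] (f : ι → Counted α) : Counted (ι → α) :=
  ⟨fun i => (f i).val, ∑ i, (f i).cost⟩

end Counted

open Counted (forAll)

/-! ## Dense linear algebra -/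

section Dense

variable {𝕜 : Type} [Field 𝕜] [StarRing 𝕜] [DecidableEq 𝕜]

/-- `∑ i, x i * y i`. -/
def dot : {m : ℕ} → (Fin m → 𝕜) → (Fin m → 𝕜) → Counted 𝕜
  | 0, _, _ => pure 0
  | _ + 1, x, y => do
      let p ← Counted.mul (x 0) (y 0)
      let s ← dot (fun i => x i.succ) (fun i => y i.succ)
      Counted.add p s

def vecAdd {m : ℕ} (x y : Fin m → 𝕜) : Counted (Fin m → 𝕜) :=
  forAll fun i => Counted.add (x i) (y i)

def matVec {m n : ℕ} (M : Matrix (Fin m) (Fin n) 𝕜) (x : Fin n → 𝕜) : Counted (Fin m → 𝕜) :=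
  forAll fun i => dot (M i) x

def matMul {l m n : ℕ} (M : Matrix (Fin l) (Fin m) 𝕜) (M' : Matrix (Fin m) (Fin n) 𝕜) :
    Counted (Matrix (Fin l) (Fin n) 𝕜) :=
  forAll fun i => forAll fun j => dot (M i) (fun s => M' s j)

def matSub {m n : ℕ} (M M' : Matrix (Fin m) (Fin n) 𝕜) : Counted (Matrix (Fin m) (Fin n) 𝕜) :=
  forAll fun i => forAll fun j => Counted.sub (M i j) (M' i j)

/-- The adjoint (conjugate transpose). -/
def matAdjoint {m n : ℕ} (M : Matrix (Fin m) (Fin n) 𝕜) : Counted (Matrix (Fin n) (Fin m) 𝕜) :=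
  forAll fun i => forAll fun j => Counted.conj (M j i)

/-- The position of the first nonzero entry (the last position if there is no earlier one). -/
def findPivot : {m : ℕ} → (Fin (m + 1) → 𝕜) → Counted (Fin (m + 1))
  | 0, _ => pure 0
  | _ + 1, v => do
      if ← Counted.isZero (v 0) then
        let p ← findPivot (fun i => v i.succ)
        pure p.succ
      else
        pure 0

/-- Inversion of a dense matrix by Gaussian elimination with row pivoting. After the rows `0` and
`p` are exchanged, the matrix is `[a, b; c, d]` with scalar `a ≠ 0`; the Schur complement
`s = d - c * a⁻¹ * b` is inverted recursively, and the inverse of `[a, b; c, d]` is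
`[a⁻¹ + a⁻¹ * b * s⁻¹ * c * a⁻¹, - a⁻¹ * b * s⁻¹; - s⁻¹ * c * a⁻¹, s⁻¹]`. -/
def gaussInv : {m : ℕ} → Matrix (Fin m) (Fin m) 𝕜 → Counted (Matrix (Fin m) (Fin m) 𝕜)
  | 0, M => pure M
  | _ + 1, M => do
      let p ← findPivot (fun i => M i 0)
      let P := M.submatrix (Equiv.swap 0 p) id
      let r ← Counted.recip (P 0 0)
      let b ← forAll fun j => Counted.mul r (P 0 (Fin.succ j))
      let S ← forAll fun i => forAll fun j => do
        let t ← Counted.mul (P (Fin.succ i) 0) (b j)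
        Counted.sub (P (Fin.succ i) (Fin.succ j)) t
      let T ← gaussInv (Matrix.of S)
      let x ← matVec T (fun i => P (Fin.succ i) 0)
      let lowerLeft ← forAll fun i => do
        let t ← Counted.mul (x i) r
        Counted.sub 0 t
      let upperRight ← forAll fun j => do
        let t ← dot b (fun i => T i j)
        Counted.sub 0 t
      let t ← dot b lowerLeft
      let upperLeft ← Counted.sub r t
      let Q : Matrix (Fin _) (Fin _) 𝕜 := Matrix.of
        (Fin.cons (Fin.cons upperLeft upperRight) fun i => Fin.cons (lowerLeft i) (T i))
      pure (Q.submatrix id (Equiv.swap 0 p))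

end Dense

/-! ## The fully populated binary tree -/

/-- The `2 ^ ℓ` boxes on level `ℓ` of the tree; a box on level `ℓ + 1` is given by its parent and
by its position (first or second) among the two children of the parent. -/
def Box : ℕ → Type
  | 0 => Unit
  | ℓ + 1 => Box ℓ × Fin 2

instance Box.instFintype : (ℓ : ℕ) → Fintype (Box ℓ)
  | 0 => inferInstanceAs (Fintype Unit)
  | ℓ + 1 =>
      letI := Box.instFintype ℓ
      inferInstanceAs (Fintype (Box ℓ × Fin 2))

instance Box.instDecidableEq : (ℓ : ℕ) → DecidableEq (Box ℓ)
  | 0 => inferInstanceAs (DecidableEq Unit)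
  | ℓ + 1 =>
      letI := Box.instDecidableEq ℓ
      inferInstanceAs (DecidableEq (Box ℓ × Fin 2))

def Box.root : Box 0 := ()

/-- The first (`a = 0`) and the second (`a = 1`) child of a box. -/
def Box.child {ℓ : ℕ} (τ : Box ℓ) (a : Fin 2) : Box (ℓ + 1) := (τ, a)

def Box.parent {ℓ : ℕ} (σ : Box (ℓ + 1)) : Box ℓ := Prod.fst σ

/-- Whether a box is the first or the second child of its parent. -/
def Box.side {ℓ : ℕ} (σ : Box (ℓ + 1)) : Fin 2 := Prod.snd σ

/-! ## Block vectors and block matrices -/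

section Blocks

variable {𝕜 : Type} {k : ℕ}

/-- The `2k × 2k` matrix with the given four `k × k` blocks. -/
def blockMatrix (M : Fin 2 → Fin 2 → Matrix (Fin k) (Fin k) 𝕜) :
    Matrix (Fin (2 * k)) (Fin (2 * k)) 𝕜 :=
  Matrix.of fun i j => M i.divNat j.divNat i.modNat j.modNat

/-- The vector `[v₀; v₁]`. -/
def stack (v : Fin 2 → Fin k → 𝕜) : Fin (2 * k) → 𝕜 :=
  fun i => v i.divNat i.modNat

/-- The halves `w₀`, `w₁` of a vector `w = [w₀; w₁]`. -/
def unstack (w : Fin (2 * k) → 𝕜) (a : Fin 2) : Fin k → 𝕜 :=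
  fun j => w (finProdFinEquiv (a, j))

/-- `2 ^ (ℓ + 1)` blocks of size `k`, regarded as `2 ^ ℓ` blocks of size `2k`. -/
def reblock {ℓ : ℕ} (p : Fin k × Box (ℓ + 1)) : Fin (2 * k) × Box ℓ :=
  (finProdFinEquiv (p.2.side, p.1), p.2.parent)

end Blocks

/-! ## Hierarchically block separable matrices -/

/-- The factors which specify an HBS matrix of block rank `k` on a tree with the levels
`0, 1, …, L + 1` whose leaves, the boxes on level `L + 1`, hold `n` points each.
The matrices `U ℓ τ` and `V ℓ τ` matter for `1 ≤ ℓ ≤ L`, and `B₁₂ ℓ τ` and `B₂₁ ℓ τ` for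
`0 ≤ ℓ ≤ L`; what these functions are on other levels is irrelevant. -/
structure HBSFactors (𝕜 : Type) (L n k : ℕ) where
  /-- The diagonal block of a leaf. -/
  D : Box (L + 1) → Matrix (Fin n) (Fin n) 𝕜
  /-- The basis matrices of a leaf. -/
  Uleaf : Box (L + 1) → Matrix (Fin n) (Fin k) 𝕜
  Vleaf : Box (L + 1) → Matrix (Fin n) (Fin k) 𝕜
  /-- The basis matrices of a parent box. -/
  U : (ℓ : ℕ) → Box ℓ → Matrix (Fin (2 * k)) (Fin k) 𝕜
  V : (ℓ : ℕ) → Box ℓ → Matrix (Fin (2 * k)) (Fin k) 𝕜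
  /-- The interaction of the first child of a parent box with the second one, and conversely. -/
  B₁₂ : (ℓ : ℕ) → Box ℓ → Matrix (Fin k) (Fin k) 𝕜
  B₂₁ : (ℓ : ℕ) → Box ℓ → Matrix (Fin k) (Fin k) 𝕜

namespace HBSFactors

variable {𝕜 : Type} {L n k N : ℕ}

section Math

variable [Field 𝕜] [StarRing 𝕜]

/-- The `N × N` matrix `A` is HBS with block rank `k`, and `H` consists of factors that specify it.
The tree is given by the index vectors `I_τ = [I (0, τ), …, I (n - 1, τ)]` of its leaves `τ`, and
`At ℓ τ τ'` is the `k × k` matrix `Ã_{τ,τ'}` for the distinct boxes `τ`, `τ'` on level `ℓ`. -/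
def Represents (H : HBSFactors 𝕜 L n k) (I : Fin n × Box (L + 1) ≃ Fin N)
    (A : Matrix (Fin N) (Fin N) 𝕜) : Prop :=
  ∃ At : (ℓ : ℕ) → Box ℓ → Box ℓ → Matrix (Fin k) (Fin k) 𝕜,
    (∀ τ τ' : Box (L + 1), τ ≠ τ' →
      A.submatrix (fun i => I (i, τ)) (fun j => I (j, τ')) =
        H.Uleaf τ * At (L + 1) τ τ' * (H.Vleaf τ').conjTranspose) ∧
    (∀ ℓ : ℕ, 1 ≤ ℓ → ℓ ≤ L → ∀ τ τ' : Box ℓ, τ ≠ τ' →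
      blockMatrix (fun a b => At (ℓ + 1) (τ.child a) (τ'.child b)) =
        H.U ℓ τ * At ℓ τ τ' * (H.V ℓ τ').conjTranspose) ∧
    (∀ τ : Box (L + 1), H.D τ = A.submatrix (fun i => I (i, τ)) (fun j => I (j, τ))) ∧
    (∀ ℓ : ℕ, ℓ ≤ L → ∀ τ : Box ℓ,
      H.B₁₂ ℓ τ = At (ℓ + 1) (τ.child 0) (τ.child 1) ∧
      H.B₂₁ ℓ τ = At (ℓ + 1) (τ.child 1) (τ.child 0))

end Math

/-- The matrix `D̃_τ` of a parent box `τ` on level `ℓ`, assembled from the matrices `D̂_σ` of the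
boxes `σ` on level `ℓ + 1`. -/
def assemble (H : HBSFactors 𝕜 L n k) (ℓ : ℕ) (Dhat : Box (ℓ + 1) → Matrix (Fin k) (Fin k) 𝕜)
    (τ : Box ℓ) : Matrix (Fin (2 * k)) (Fin (2 * k)) 𝕜 :=
  blockMatrix ![![Dhat (τ.child 0), H.B₁₂ ℓ τ], ![H.B₂₁ ℓ τ, Dhat (τ.child 1)]]

section Nonsingular

variable [Field 𝕜] [StarRing 𝕜]

/-- None of the matrices that the inversion algorithm has to invert on the levels
`ℓ, ℓ - 1, …, 0` is singular, if it starts from the matrices `D̂_σ` on level `ℓ + 1`. -/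
def UpperNonsingular (H : HBSFactors 𝕜 L n k) :
    (ℓ : ℕ) → (Box (ℓ + 1) → Matrix (Fin k) (Fin k) 𝕜) → Prop
  | 0, Dhat => IsUnit (H.assemble 0 Dhat Box.root)
  | ℓ + 1, Dhat =>
      (∀ τ : Box (ℓ + 1), IsUnit (H.assemble (ℓ + 1) Dhat τ) ∧
        IsUnit ((H.V (ℓ + 1) τ).conjTranspose * (H.assemble (ℓ + 1) Dhat τ)⁻¹ * H.U (ℓ + 1) τ)) ∧
      H.UpperNonsingular ℓ fun τ =>
        ((H.V (ℓ + 1) τ).conjTranspose * (H.assemble (ℓ + 1) Dhat τ)⁻¹ * H.U (ℓ + 1) τ)⁻¹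

/-- None of the matrices that the inversion algorithm has to invert is singular. These are
`D̃_τ` and `V_τ^* D̃_τ⁻¹ U_τ` for every box `τ` other than the root, and the `2k × 2k` matrix of
the root. -/
def Nonsingular (H : HBSFactors 𝕜 L n k) : Prop :=
  (∀ τ : Box (L + 1), IsUnit (H.D τ) ∧
    IsUnit ((H.Vleaf τ).conjTranspose * (H.D τ)⁻¹ * H.Uleaf τ)) ∧
  H.UpperNonsingular L fun τ => ((H.Vleaf τ).conjTranspose * (H.D τ)⁻¹ * H.Uleaf τ)⁻¹

end Nonsingular

end HBSFactors

/-! ## The data-sparse format of the inverse -/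

/-- Factors for a matrix with `2 ^ (ℓ + 1)` blocks of size `k`: the matrices `E_τ`, `F_τ^*`, `G_τ`
for the boxes `τ` on the levels `ℓ, ℓ - 1, …, 1`, and the matrix `G₁` for the root. -/
inductive UpperInverse (𝕜 : Type) (k : ℕ) : ℕ → Type
  | root (G₁ : Matrix (Fin (2 * k)) (Fin (2 * k)) 𝕜) : UpperInverse 𝕜 k 0
  | level {ℓ : ℕ} (E : Box (ℓ + 1) → Matrix (Fin (2 * k)) (Fin k) 𝕜)
      (Fadj : Box (ℓ + 1) → Matrix (Fin k) (Fin (2 * k)) 𝕜)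
      (G : Box (ℓ + 1) → Matrix (Fin (2 * k)) (Fin (2 * k)) 𝕜)
      (coarser : UpperInverse 𝕜 k ℓ) : UpperInverse 𝕜 k (ℓ + 1)

/-- The same for a matrix with `2 ^ (L + 1)` blocks of size `n`, where the boxes on level `L + 1`
are leaves. -/
structure InverseFactors (𝕜 : Type) (L n k : ℕ) where
  E : Box (L + 1) → Matrix (Fin n) (Fin k) 𝕜
  Fadj : Box (L + 1) → Matrix (Fin k) (Fin n) 𝕜
  G : Box (L + 1) → Matrix (Fin n) (Fin n) 𝕜
  coarser : UpperInverse 𝕜 k L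

/-- The number of stored scalars. -/
def UpperInverse.storage {𝕜 : Type} {k : ℕ} : {ℓ : ℕ} → UpperInverse 𝕜 k ℓ → ℕ
  | _, .root _ => (2 * k) * (2 * k)
  | ℓ + 1, .level _ _ _ coarser =>
      2 ^ (ℓ + 1) * ((2 * k) * k + k * (2 * k) + (2 * k) * (2 * k)) + coarser.storage

/-- The number of stored scalars. -/
def InverseFactors.storage {𝕜 : Type} {L n k : ℕ} (R : InverseFactors 𝕜 L n k) : ℕ :=
  2 ^ (L + 1) * (n * k + k * n + n * n) + R.coarser.storage

section Represented

variable {𝕜 : Type} [Field 𝕜]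

/-- The represented matrix: `G₁` for the root, and
`diag(E_τ) * (represented by the coarser levels) * diag(F_τ^*) + diag(G_τ)` otherwise. -/
def UpperInverse.toMatrix {k : ℕ} : {ℓ : ℕ} → UpperInverse 𝕜 k ℓ →
    Matrix (Fin k × Box (ℓ + 1)) (Fin k × Box (ℓ + 1)) 𝕜
  | _, .root G₁ => (Matrix.blockDiagonal fun _ : Box 0 => G₁).submatrix reblock reblock
  | _ + 1, .level E Fadj G coarser =>
      (Matrix.blockDiagonal E * coarser.toMatrix * Matrix.blockDiagonal Fadj +
        Matrix.blockDiagonal G).submatrix reblock reblock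

/-- The represented `N × N` matrix, where `I` lists the indices in the leaves. -/
def InverseFactors.toMatrix {L n k N : ℕ} (R : InverseFactors 𝕜 L n k)
    (I : Fin n × Box (L + 1) ≃ Fin N) : Matrix (Fin N) (Fin N) 𝕜 :=
  (Matrix.blockDiagonal R.E * R.coarser.toMatrix * Matrix.blockDiagonal R.Fadj +
    Matrix.blockDiagonal R.G).submatrix I.symm I.symm

end Represented

/-! ## The inversion algorithm -/

/-- The matrices computed for one box with `m` points. -/
structure BoxFactors (𝕜 : Type) (m k : ℕ) where
  Dhat : Matrix (Fin k) (Fin k) 𝕜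
  E : Matrix (Fin m) (Fin k) 𝕜
  Fadj : Matrix (Fin k) (Fin m) 𝕜
  G : Matrix (Fin m) (Fin m) 𝕜

section Algorithms

variable {𝕜 : Type} [Field 𝕜] [StarRing 𝕜] [DecidableEq 𝕜]

/-- The work for one box:
`D̂ = (V^* D̃⁻¹ U)⁻¹`, `E = D̃⁻¹ U D̂`, `F^* = D̂ V^* D̃⁻¹`, `G = D̃⁻¹ - D̃⁻¹ U D̂ V^* D̃⁻¹`. -/
def boxFactors {m k : ℕ} (Dtilde : Matrix (Fin m) (Fin m) 𝕜) (U V : Matrix (Fin m) (Fin k) 𝕜) :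
    Counted (BoxFactors 𝕜 m k) := do
  let X ← gaussInv Dtilde
  let Vadj ← matAdjoint V
  let XU ← matMul X U
  let VX ← matMul Vadj X
  let W ← matMul Vadj XU
  let Dhat ← gaussInv W
  let E ← matMul XU Dhat
  let Fadj ← matMul Dhat VX
  let Y ← matMul E VX
  let G ← matSub X Y
  pure ⟨Dhat, E, Fadj, G⟩

/-- The levels `ℓ, ℓ - 1, …, 0` of the inversion, starting from `D̂_σ` on level `ℓ + 1`. -/
def invertUpper {L n k : ℕ} (H : HBSFactors 𝕜 L n k) :
    (ℓ : ℕ) → (Box (ℓ + 1) → Matrix (Fin k) (Fin k) 𝕜) → Counted (UpperInverse 𝕜 k ℓ)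
  | 0, Dhat => do
      let G₁ ← gaussInv (H.assemble 0 Dhat Box.root)
      pure (.root G₁)
  | ℓ + 1, Dhat => do
      let f ← forAll fun τ : Box (ℓ + 1) =>
        boxFactors (H.assemble (ℓ + 1) Dhat τ) (H.U (ℓ + 1) τ) (H.V (ℓ + 1) τ)
      let coarser ← invertUpper H ℓ fun τ => (f τ).Dhat
      pure (.level (fun τ => (f τ).E) (fun τ => (f τ).Fadj) (fun τ => (f τ).G) coarser)

/-- Inversion of an HBS matrix, level by level, from the leaves to the root. -/
def invertHBS {L n k : ℕ} (H : HBSFactors 𝕜 L n k) : Counted (InverseFactors 𝕜 L n k) := do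
  let f ← forAll fun τ : Box (L + 1) => boxFactors (H.D τ) (H.Uleaf τ) (H.Vleaf τ)
  let coarser ← invertUpper H L fun τ => (f τ).Dhat
  pure ⟨fun τ => (f τ).E, fun τ => (f τ).Fadj, fun τ => (f τ).G, coarser⟩

/-! ## Application of the computed inverse to a vector -/

/-- Given the vectors `û_σ` on level `ℓ + 1`, compute the vectors `q̂_σ` on that level. On each
level, the line before the recursive call is the upward pass, and what follows it is the downward
pass. -/
def applyUpper {k : ℕ} : {ℓ : ℕ} → UpperInverse 𝕜 k ℓ → (Box (ℓ + 1) → Fin k → 𝕜) →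
    Counted (Box (ℓ + 1) → Fin k → 𝕜)
  | _, .root G₁, uhat => do
      let w ← matVec G₁ (stack fun a => uhat (Box.root.child a))
      pure fun σ => unstack w σ.side
  | ℓ + 1, .level E Fadj G coarser, uhat => do
      let uhat' ← forAll fun τ : Box (ℓ + 1) => matVec (Fadj τ) (stack fun a => uhat (τ.child a))
      let qhat ← applyUpper coarser uhat'
      let w ← forAll fun τ : Box (ℓ + 1) => do
        let x ← matVec (E τ) (qhat τ)
        let y ← matVec (G τ) (stack fun a => uhat (τ.child a))
        vecAdd x y
      pure fun σ => unstack (w σ.parent) σ.side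

/-- The product of the represented matrix with the vector `u`. -/
def applyInverse {L n k N : ℕ} (R : InverseFactors 𝕜 L n k) (I : Fin n × Box (L + 1) ≃ Fin N)
    (u : Fin N → 𝕜) : Counted (Fin N → 𝕜) := do
  let uhat ← forAll fun τ : Box (L + 1) => matVec (R.Fadj τ) (fun i => u (I (i, τ)))
  let qhat ← applyUpper R.coarser uhat
  let q ← forAll fun τ : Box (L + 1) => do
    let x ← matVec (R.E τ) (qhat τ)
    let y ← matVec (R.G τ) (fun i => u (I (i, τ)))
    vecAdd x y
  pure fun s => q (I.symm s).2 (I.symm s).1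

end Algorithms

/-! Write `M` for the block matrix of one level, with the computed `D̂_τ` on the diagonal and the
`Ã_{τ,τ'}` off it (`levelMatrix`). Subtracting the diagonal removes `D̂`, so the nested HBS
conditions say that the matrix one level finer, grouped into blocks of pairs of siblings, is `U (M -
D̂) V^* + D̃` with block diagonal `U`, `V`, `D̃` (`levelMatrix_succ`); the same holds for `A` at the
leaves. Any diagonal could be subtracted here. The choice `D̂ = (V^* D̃⁻¹ U)⁻¹` makes the inverse of
this sum equal to `E M⁻¹ F^* + G` (`Matrix.compressed_inverse`). Induction from the root to the
leaves then gives exactness (`levelMatrix_mul_invertUpper`, `invertHBS_toMatrix`). The dense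
inversions are correct because the Schur complement of a nonzero pivot in a nonsingular matrix is
again nonsingular (`gaussInv_val`).

For the costs, a box needs `O(k³)` operations to invert, and `O(k²)` scalars and operations to store
and apply. The number of boxes doubles from level to level, so the leaf level dominates up to a
factor 2. This bounds the totals by multiples of `2 ^ (L + 1) * k ^ 3` and `2 ^ (L + 1) * k ^ 2`.
Since `V^* D⁻¹ U` is an invertible `k × k` matrix that factors through dimension `n`, also `k ≤ n`
(`Nonsingular.rank_le`), and one factor `k` can be traded for `n` to produce `N`. -/

/-! ### Values and costs of counted computations -/

namespace Counted

@[simp]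
theorem val_pure {α : Type} (a : α) : (pure a : Counted α).val = a := rfl

@[simp]
theorem cost_pure {α : Type} (a : α) : (pure a : Counted α).cost = 0 := rfl

@[simp]
theorem val_bind {α β : Type} (x : Counted α) (f : α → Counted β) :
    (x >>= f).val = (f x.val).val := rfl

@[simp]
theorem cost_bind {α β : Type} (x : Counted α) (f : α → Counted β) :
    (x >>= f).cost = x.cost + (f x.val).cost := rfl

@[simp]
theorem val_forAll {ι α : Type} [Fintype ι] (f : ι → Counted α) :
    (forAll f).val = fun i => (f i).val := rfl

@[simp]
theorem cost_forAll {ι α : Type} [Fintype ι] (f : ι → Counted α) :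
    (forAll f).cost = ∑ i, (f i).cost := rfl

theorem cost_forAll_le {ι α : Type} [Fintype ι] (f : ι → Counted α) (c : ℕ)
    (h : ∀ i, (f i).cost ≤ c) : (forAll f).cost ≤ Fintype.card ι * c := by
  simpa using Finset.sum_le_card_nsmul Finset.univ (fun i => (f i).cost) c fun i _ => h i

section Scalar

variable {𝕜 : Type} [Field 𝕜]

@[simp] theorem val_add (x y : 𝕜) : (Counted.add x y).val = x + y := rfl
@[simp] theorem cost_add (x y : 𝕜) : (Counted.add x y).cost = 1 := rfl
@[simp] theorem val_sub (x y : 𝕜) : (Counted.sub x y).val = x - y := rfl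
@[simp] theorem cost_sub (x y : 𝕜) : (Counted.sub x y).cost = 1 := rfl
@[simp] theorem val_mul (x y : 𝕜) : (Counted.mul x y).val = x * y := rfl
@[simp] theorem cost_mul (x y : 𝕜) : (Counted.mul x y).cost = 1 := rfl
@[simp] theorem val_recip (x : 𝕜) : (Counted.recip x).val = x⁻¹ := rfl
@[simp] theorem cost_recip (x : 𝕜) : (Counted.recip x).cost = 1 := rfl
@[simp] theorem cost_conj [StarRing 𝕜] (x : 𝕜) : (Counted.conj x).cost = 1 := rfl
@[simp] theorem val_isZero [DecidableEq 𝕜] (x : 𝕜) : (Counted.isZero x).val = decide (x = 0) := rfl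
@[simp] theorem cost_isZero [DecidableEq 𝕜] (x : 𝕜) : (Counted.isZero x).cost = 1 := rfl

end Scalar

end Counted

/-! ### Dense linear algebra and Gaussian elimination -/

section Dense

variable {𝕜 : Type} [Field 𝕜]

@[simp]
theorem dot_val {m : ℕ} (x y : Fin m → 𝕜) : (dot x y).val = x ⬝ᵥ y := by
  induction m with
  | zero => simp [dot]
  | succ m ih => simp [dot, ih, dotProduct, Fin.sum_univ_succ]

@[simp]
theorem dot_cost {m : ℕ} (x y : Fin m → 𝕜) : (dot x y).cost = 2 * m := by
  induction m with
  | zero => simp [dot]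
  | succ m ih => simp [dot, ih]; ring

@[simp]
theorem vecAdd_val {m : ℕ} (x y : Fin m → 𝕜) : (vecAdd x y).val = x + y := rfl

@[simp]
theorem vecAdd_cost {m : ℕ} (x y : Fin m → 𝕜) : (vecAdd x y).cost = m := by
  simp [vecAdd]

@[simp]
theorem matVec_val {m n : ℕ} (M : Matrix (Fin m) (Fin n) 𝕜) (x : Fin n → 𝕜) :
    (matVec M x).val = M.mulVec x := by
  ext i
  simp [matVec, Matrix.mulVec]

@[simp]
theorem matVec_cost {m n : ℕ} (M : Matrix (Fin m) (Fin n) 𝕜) (x : Fin n → 𝕜) :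
    (matVec M x).cost = m * (2 * n) := by
  simp [matVec]

@[simp]
theorem matMul_val {l m n : ℕ} (M : Matrix (Fin l) (Fin m) 𝕜) (M' : Matrix (Fin m) (Fin n) 𝕜) :
    (matMul M M').val = M * M' := by
  ext i j
  simp [matMul, Matrix.mul_apply, dotProduct]

@[simp]
theorem matMul_cost {l m n : ℕ} (M : Matrix (Fin l) (Fin m) 𝕜) (M' : Matrix (Fin m) (Fin n) 𝕜) :
    (matMul M M').cost = l * (n * (2 * m)) := by
  simp [matMul]

@[simp]
theorem matSub_val {m n : ℕ} (M M' : Matrix (Fin m) (Fin n) 𝕜) :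
    (matSub M M').val = M - M' := rfl

@[simp]
theorem matSub_cost {m n : ℕ} (M M' : Matrix (Fin m) (Fin n) 𝕜) :
    (matSub M M').cost = m * n := by
  simp [matSub]

@[simp]
theorem matAdjoint_val [StarRing 𝕜] {m n : ℕ} (M : Matrix (Fin m) (Fin n) 𝕜) :
    (matAdjoint M).val = M.conjTranspose := rfl

@[simp]
theorem matAdjoint_cost [StarRing 𝕜] {m n : ℕ} (M : Matrix (Fin m) (Fin n) 𝕜) :
    (matAdjoint M).cost = n * m := by
  simp [matAdjoint]

theorem findPivot_cost_le [DecidableEq 𝕜] {m : ℕ} (v : Fin (m + 1) → 𝕜) : (findPivot v).cost ≤ m := by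
  induction m with
  | zero => simp [findPivot]
  | succ m ih =>
    by_cases h : v 0 = 0
    · have := ih fun i => v i.succ
      simp only [findPivot, Counted.cost_bind, Counted.val_isZero, h, Counted.cost_isZero,
        decide_true, if_true, Counted.cost_pure]
      lia
    · simp [findPivot, h]

theorem findPivot_val_ne_zero [DecidableEq 𝕜] {m : ℕ} (v : Fin (m + 1) → 𝕜) (hv : v ≠ 0) :
    v (findPivot v).val ≠ 0 := by
  induction m with
  | zero =>
    intro h
    apply hv
    ext i
    rwa [Subsingleton.elim (α := Fin 1) i (findPivot v).val]
  | succ m ih =>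
    by_cases h : v 0 = 0
    · simp only [findPivot, Counted.val_bind, Counted.val_isZero, h, decide_true, if_true,
        Counted.val_pure]
      refine ih (fun i => v i.succ) fun h' => hv ?_
      ext i
      refine Fin.cases h (fun j => congrFun h' j) i
    · simp [findPivot, h]

/-- The Schur complement of the entry at position `(0, 0)`. -/
def schurComplement {m : ℕ} (P : Matrix (Fin (m + 1)) (Fin (m + 1)) 𝕜) : Matrix (Fin m) (Fin m) 𝕜 :=
  Matrix.of fun i j => P i.succ j.succ - P i.succ 0 * ((P 0 0)⁻¹ * P 0 j.succ)

/-- The inverse of a matrix in terms of the inverse `T` of its Schur complement. -/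
def borderedInverse {m : ℕ} (P : Matrix (Fin (m + 1)) (Fin (m + 1)) 𝕜)
    (T : Matrix (Fin m) (Fin m) 𝕜) : Matrix (Fin (m + 1)) (Fin (m + 1)) 𝕜 :=
  let r := (P 0 0)⁻¹
  let b : Fin m → 𝕜 := fun j => r * P 0 j.succ
  let lowerLeft : Fin m → 𝕜 := fun i => 0 - T.mulVec (fun i => P i.succ 0) i * r
  let upperRight : Fin m → 𝕜 := fun j => 0 - b ⬝ᵥ (fun i => T i j)
  Matrix.of (Fin.cons (Fin.cons (r - b ⬝ᵥ lowerLeft) upperRight)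
    fun i => Fin.cons (lowerLeft i) (T i))

theorem borderedInverse_mul {m : ℕ} (P : Matrix (Fin (m + 1)) (Fin (m + 1)) 𝕜)
    (T : Matrix (Fin m) (Fin m) 𝕜) (ha : P 0 0 ≠ 0) (hT : T * schurComplement P = 1) :
    borderedInverse P T * P = 1 := by
  set r := (P 0 0)⁻¹ with hr
  set b : Fin m → 𝕜 := fun j => r * P 0 j.succ with hb
  set c : Fin m → 𝕜 := fun i => P i.succ 0 with hc
  have hra : r * P 0 0 = 1 := inv_mul_cancel₀ ha
  -- With `P = [a, b'; c, d]` and `b = a⁻¹ b'`, the Schur complement is `d - c b`, so `T (d - c b) =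
  -- 1` gives `T d = 1 + (T c) b`.
  have hTd : ∀ i j, ∑ s, T i s * P s.succ j.succ =
      (1 : Matrix (Fin m) (Fin m) 𝕜) i j + T.mulVec c i * b j := by
    intro i j
    rw [← hT, Matrix.mul_apply, Matrix.mulVec, dotProduct, Finset.sum_mul,
      ← Finset.sum_add_distrib]
    refine Finset.sum_congr rfl fun s _ => ?_
    simp only [schurComplement, Matrix.of_apply, hb, hc, ← hr]
    ring
  have hbT : ∀ f : Fin m → 𝕜, ∑ j, (b ⬝ᵥ fun i => T i j) * f j = b ⬝ᵥ T.mulVec f := by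
    intro f
    simp only [dotProduct, Matrix.mulVec, Finset.sum_mul, Finset.mul_sum]
    rw [Finset.sum_comm]
    simp only [mul_assoc]
  have hbd : ∀ j, ∑ s, (b ⬝ᵥ fun i => T i s) * P s.succ j.succ =
      b j + (b ⬝ᵥ T.mulVec c) * b j := by
    intro j
    rw [hbT fun s => P s.succ j.succ]
    simp only [dotProduct, Matrix.mulVec] at hTd ⊢
    simp only [hTd, mul_add, Finset.sum_add_distrib, Finset.sum_mul, mul_assoc]
    simp [Matrix.one_apply]
  have hbl : b ⬝ᵥ (fun i => -(T.mulVec c i * r)) = - ((b ⬝ᵥ T.mulVec c) * r) := by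
    simp [dotProduct, Finset.sum_mul, mul_assoc]
  ext i j
  rw [Matrix.mul_apply, Fin.sum_univ_succ]
  refine Fin.cases ?_ (fun i => ?_) i <;> refine Fin.cases ?_ (fun j => ?_) j
  · simp only [borderedInverse, Matrix.of_apply, Fin.cons_zero, Fin.cons_succ, ← hr, ← hb, ← hc,
      zero_sub, hbl, neg_mul, Finset.sum_neg_distrib, Matrix.one_apply_eq]
    rw [show ∑ s : Fin m, (b ⬝ᵥ fun i => T i s) * P s.succ 0 = _ from hbT c]
    linear_combination (1 + b ⬝ᵥ T.mulVec c) * hra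
  · simp only [borderedInverse, Matrix.of_apply, Fin.cons_zero, Fin.cons_succ, ← hr, ← hb, ← hc,
      zero_sub, hbl, neg_mul, Finset.sum_neg_distrib, hbd]
    rw [Matrix.one_apply_ne (Fin.succ_ne_zero j).symm]
    simp only [hb]
    ring
  · simp only [borderedInverse, Matrix.of_apply, Fin.cons_zero, Fin.cons_succ, ← hr, ← hb, ← hc]
    rw [Matrix.one_apply_ne (Fin.succ_ne_zero i),
      show ∑ s : Fin m, T i s * P s.succ 0 = T.mulVec c i from rfl]
    linear_combination -(T.mulVec c i) * hra
  · simp only [borderedInverse, Matrix.of_apply, Fin.cons_zero, Fin.cons_succ, ← hr, ← hb, ← hc,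
      hTd]
    simp only [Matrix.one_apply, Fin.succ_inj, hb]
    ring

theorem isUnit_schurComplement {m : ℕ} (P : Matrix (Fin (m + 1)) (Fin (m + 1)) 𝕜)
    (ha : P 0 0 ≠ 0) (hP : IsUnit P) : IsUnit (schurComplement P) := by
  rw [← Matrix.mulVec_injective_iff_isUnit] at hP ⊢
  rw [← Matrix.coe_mulVecLin, ← LinearMap.ker_eq_bot, LinearMap.ker_eq_bot'] at hP ⊢
  intro y hy
  -- A kernel vector `y` of the Schur complement extends to a kernel vector of `P`; the new first
  -- entry is the one forced by row `0`.
  have h := hP (Fin.cons (-∑ j, (P 0 0)⁻¹ * P 0 j.succ * y j) y) (by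
    ext i
    rw [Matrix.mulVecLin_apply, Matrix.mulVec, dotProduct, Fin.sum_univ_succ]
    simp only [Fin.cons_zero, Fin.cons_succ]
    refine Fin.cases ?_ (fun i => ?_) i
    · simp only [mul_assoc, ← Finset.mul_sum]
      simp [ha]
    · have h := congrFun hy i
      rw [Matrix.mulVecLin_apply, Matrix.mulVec, dotProduct] at h
      simp only [schurComplement, Matrix.of_apply, sub_mul, Finset.sum_sub_distrib, mul_assoc,
        ← Finset.mul_sum] at h
      simp only [mul_assoc, ← Finset.mul_sum]
      rw [mul_neg, neg_add_eq_sub]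
      exact h)
  ext i
  exact congrFun h i.succ

/-- Separates the algebra from the bookkeeping. `schurComplement` and `borderedInverse` use the very
expressions of the program, including `0 - x` for negation, so that `rfl` finishes. -/
theorem gaussInv_succ_val [DecidableEq 𝕜] {m : ℕ} (M : Matrix (Fin (m + 1)) (Fin (m + 1)) 𝕜) :
    (gaussInv M).val =
      (borderedInverse (M.submatrix (Equiv.swap 0 (findPivot fun i => M i 0).val) id)
        (gaussInv (schurComplement
          (M.submatrix (Equiv.swap 0 (findPivot fun i => M i 0).val) id))).val).submatrix id
        (Equiv.swap 0 (findPivot fun i => M i 0).val) := by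
  rw [gaussInv]
  simp only [Counted.val_bind, Counted.val_pure, Counted.val_forAll, Counted.val_mul,
    Counted.val_sub, Counted.val_recip, dot_val, matVec_val]
  rfl

/-- Gaussian elimination inverts every nonsingular matrix. -/
theorem gaussInv_val [DecidableEq 𝕜] {m : ℕ} (M : Matrix (Fin m) (Fin m) 𝕜) (hM : IsUnit M) :
    (gaussInv M).val = M⁻¹ := by
  induction m with
  | zero => exact Subsingleton.elim _ _
  | succ m ih =>
    rw [gaussInv_succ_val]
    set p := (findPivot fun i => M i 0).val with hp
    set P := M.submatrix (Equiv.swap 0 p) id with hPdef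
    -- A zero first column would put the first unit vector into the kernel, so the pivot search
    -- succeeds.
    have hcol : (fun i => M i 0) ≠ 0 := by
      intro h
      rw [← Matrix.mulVec_injective_iff_isUnit] at hM
      have h1 : M.mulVec (Pi.single 0 1) = M.mulVec 0 := by
        rw [Matrix.mulVec_single_one, Matrix.mulVec_zero]
        exact h
      simpa using congrFun (hM h1) 0
    have ha : P 0 0 ≠ 0 := by
      simpa [hPdef] using findPivot_val_ne_zero _ hcol
    have hP : IsUnit P := by
      rw [hPdef]
      exact (Matrix.isUnit_submatrix_equiv (Equiv.swap 0 p) (Equiv.refl _)).2 hM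
    have hS := isUnit_schurComplement P ha hP
    rw [ih _ hS]
    symm
    apply Matrix.inv_eq_left_inv
    have h := borderedInverse_mul P (schurComplement P)⁻¹ ha
      (Matrix.nonsing_inv_mul _ ((Matrix.isUnit_iff_isUnit_det _).1 hS))
    rw [← h]
    ext i j
    simp only [Matrix.mul_apply, Matrix.submatrix_apply, id]
    -- Swapping the columns of the left factor amounts to swapping the rows of `M`, which turns `M`
    -- into `P`.
    rw [← Equiv.sum_comp (Equiv.swap 0 p)]
    simp only [Equiv.swap_apply_self]
    rfl

theorem gaussInv_cost_le [DecidableEq 𝕜] {m : ℕ} (M : Matrix (Fin m) (Fin m) 𝕜) :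
    (gaussInv M).cost ≤ 3 * m ^ 3 := by
  induction m with
  | zero => simp [gaussInv]
  | succ m ih =>
    rw [gaussInv]
    simp only [Counted.cost_bind, Counted.cost_pure, Counted.cost_forAll, Counted.cost_mul,
      Counted.cost_sub, Counted.cost_recip, dot_cost, matVec_cost, Finset.sum_const,
      Finset.card_univ, Fintype.card_fin, smul_eq_mul]
    refine (add_le_add (findPivot_cost_le _) (add_le_add_right (add_le_add_right
      (add_le_add_right (add_le_add_left (ih _) _) _) _) _)).trans ?_
    -- Apart from the recursive call, the cost is at most `6m² + 7m + 2`, while `3(m+1)³ - 3m³ = 9m²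
    -- + 9m + 3`.
    nlinarith

end Dense

/-! ### Boxes, regrouping of siblings, and block diagonal matrices -/

theorem Box.card (ℓ : ℕ) : Fintype.card (Box ℓ) = 2 ^ ℓ := by
  induction ℓ with
  | zero => rfl
  | succ ℓ ih =>
    rw [pow_succ, ← ih]
    exact (Fintype.card_prod (Box ℓ) (Fin 2)).trans (by simp)

/-- `reblock` as an equivalence. -/
def reblockEquiv {k : ℕ} (ℓ : ℕ) : Fin k × Box (ℓ + 1) ≃ Fin (2 * k) × Box ℓ where
  toFun := reblock
  invFun p := (p.1.modNat, p.2.child p.1.divNat)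
  left_inv := by
    rintro ⟨j, τ, a⟩
    have h := finProdFinEquiv.symm_apply_apply (a, j)
    exact Prod.ext (congrArg Prod.snd h) (Prod.ext rfl (congrArg Prod.fst h))
  right_inv := by
    rintro ⟨i, τ⟩
    exact Prod.ext (finProdFinEquiv.apply_symm_apply i) rfl

theorem blockMatrix_reblock {𝕜 : Type} {k ℓ : ℕ} (M : Fin 2 → Fin 2 → Matrix (Fin k) (Fin k) 𝕜)
    (p q : Fin k × Box (ℓ + 1)) :
    blockMatrix M (reblock p).1 (reblock q).1 = M p.2.side q.2.side p.1 q.1 := by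
  have hp := finProdFinEquiv.symm_apply_apply (p.2.side, p.1)
  have hq := finProdFinEquiv.symm_apply_apply (q.2.side, q.1)
  rw [finProdFinEquiv_symm_apply, Prod.mk.injEq] at hp hq
  simp only [blockMatrix, Matrix.of_apply, reblock]
  rw [hp.1, hp.2, hq.1, hq.2]

section BlockDiagonal

variable {𝕜 m n l r o : Type} [Field 𝕜] [DecidableEq o]

theorem Matrix.blockDiagonal_mulVec [Fintype n] [Fintype o] (M : o → Matrix m n 𝕜)
    (v : n × o → 𝕜) (p : m × o) :
    (blockDiagonal M).mulVec v p = (M p.2).mulVec (fun j => v (j, p.2)) p.1 := by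
  simp only [mulVec, dotProduct, Fintype.sum_prod_type, blockDiagonal_apply]
  refine Finset.sum_congr rfl fun j _ => ?_
  simp [ite_mul]

theorem Matrix.blockDiagonal_mul_mul_apply [Fintype n] [Fintype l] [Fintype o]
    (U : o → Matrix m n 𝕜) (X : Matrix (n × o) (l × o) 𝕜) (W : o → Matrix l r 𝕜) (p : m × o)
    (q : r × o) :
    (blockDiagonal U * X * blockDiagonal W) p q =
      (U p.2 * X.submatrix (fun i => (i, p.2)) (fun j => (j, q.2)) * W q.2) p.1 q.1 := by
  simp only [mul_apply, Fintype.sum_prod_type, blockDiagonal_apply, submatrix_apply]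
  refine Finset.sum_congr rfl fun j _ => ?_
  simp [ite_mul]

end BlockDiagonal

/-! ### Inversion of one level -/

/-- The inverse of `U (M - D̂) V^* + D` in terms of an inverse `X` of `M`, if `D̂` is the inverse of
`V^* D⁻¹ U`. -/
theorem Matrix.compressed_inverse {𝕜 m κ : Type} [Field 𝕜] [Fintype m] [DecidableEq m] [Fintype κ]
    [DecidableEq κ] (D Y : Matrix m m 𝕜) (U : Matrix m κ 𝕜) (W : Matrix κ m 𝕜)
    (Dhat M X : Matrix κ κ 𝕜) (hY : D * Y = 1) (hDhat : W * Y * U * Dhat = 1) (hX : M * X = 1) :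
    (U * (M - Dhat) * W + D) *
      (Y * U * Dhat * X * (Dhat * (W * Y)) + (Y - Y * U * Dhat * (W * Y))) = 1 := by
  -- With `E = Y U D̂` and `G = Y - E W Y`, this says `W E = 1`, hence `W G = 0`: multiplication by
  -- `W` leaves only `X D̂ W Y`. Since `D E = U D̂`, the terms containing `D̂ X` cancel, and `M X =
  -- 1` cancels the rest.
  have hWE : W * (Y * U * Dhat) = 1 := by simpa only [Matrix.mul_assoc] using hDhat
  have hDE : D * (Y * U * Dhat) = U * Dhat := by
    rw [← Matrix.mul_assoc, ← Matrix.mul_assoc, hY, Matrix.one_mul]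
  have hW : W * (Y * U * Dhat * X * (Dhat * (W * Y)) + (Y - Y * U * Dhat * (W * Y))) =
      X * (Dhat * (W * Y)) := by
    rw [Matrix.mul_add, Matrix.mul_sub, ← Matrix.mul_assoc W (Y * U * Dhat), hWE, Matrix.one_mul,
      sub_self, add_zero, Matrix.mul_assoc _ X, ← Matrix.mul_assoc W (Y * U * Dhat), hWE,
      Matrix.one_mul]
  have hD : D * (Y * U * Dhat * X * (Dhat * (W * Y)) + (Y - Y * U * Dhat * (W * Y))) =
      U * Dhat * X * (Dhat * (W * Y)) + (1 - U * Dhat * (W * Y)) := by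
    rw [Matrix.mul_add, Matrix.mul_sub, ← Matrix.mul_assoc D (Y * U * Dhat), hDE, hY,
      Matrix.mul_assoc _ X, ← Matrix.mul_assoc D (Y * U * Dhat), hDE, Matrix.mul_assoc _ X]
  rw [Matrix.add_mul, hD, Matrix.mul_assoc _ W, hW, Matrix.mul_sub, Matrix.sub_mul,
    Matrix.mul_assoc U M, ← Matrix.mul_assoc M X, hX, Matrix.one_mul]
  simp only [Matrix.mul_assoc]
  abel

section BoxFactors

variable {𝕜 : Type} [Field 𝕜] [StarRing 𝕜] [DecidableEq 𝕜]

theorem boxFactors_val {m k : ℕ} (D : Matrix (Fin m) (Fin m) 𝕜) (U V : Matrix (Fin m) (Fin k) 𝕜)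
    (hD : IsUnit D) (hW : IsUnit (V.conjTranspose * D⁻¹ * U)) :
    (boxFactors D U V).val =
      ⟨(V.conjTranspose * D⁻¹ * U)⁻¹, D⁻¹ * U * (V.conjTranspose * D⁻¹ * U)⁻¹,
        (V.conjTranspose * D⁻¹ * U)⁻¹ * (V.conjTranspose * D⁻¹),
        D⁻¹ - D⁻¹ * U * (V.conjTranspose * D⁻¹ * U)⁻¹ * (V.conjTranspose * D⁻¹)⟩ := by
  simp only [boxFactors, Counted.val_bind, Counted.val_pure, matMul_val, matAdjoint_val,
    matSub_val, gaussInv_val D hD, ← Matrix.mul_assoc V.conjTranspose D⁻¹ U,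
    gaussInv_val _ hW]

/-- Block diagonal matrices multiply blockwise, so the identities required by
`Matrix.compressed_inverse` for a whole level only need to be checked box by box. -/
theorem boxFactors_compressed_inverse {m k : ℕ} {o : Type} [Fintype o] [DecidableEq o]
    (D : o → Matrix (Fin m) (Fin m) 𝕜) (U V : o → Matrix (Fin m) (Fin k) 𝕜)
    (h : ∀ τ, IsUnit (D τ) ∧ IsUnit ((V τ).conjTranspose * (D τ)⁻¹ * U τ))
    (M X : Matrix (Fin k × o) (Fin k × o) 𝕜) (hX : M * X = 1) :
    (Matrix.blockDiagonal U *
          (M - Matrix.blockDiagonal fun τ => ((V τ).conjTranspose * (D τ)⁻¹ * U τ)⁻¹) *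
          (Matrix.blockDiagonal fun τ => (V τ).conjTranspose) + Matrix.blockDiagonal D) *
      ((Matrix.blockDiagonal fun τ => (boxFactors (D τ) (U τ) (V τ)).val.E) * X *
          (Matrix.blockDiagonal fun τ => (boxFactors (D τ) (U τ) (V τ)).val.Fadj) +
        Matrix.blockDiagonal fun τ => (boxFactors (D τ) (U τ) (V τ)).val.G) = 1 := by
  have hf := fun τ => boxFactors_val (D τ) (U τ) (V τ) (h τ).1 (h τ).2
  simp only [hf]
  rw [show (Matrix.blockDiagonal fun τ => (D τ)⁻¹ - (D τ)⁻¹ * U τ *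
      ((V τ).conjTranspose * (D τ)⁻¹ * U τ)⁻¹ * ((V τ).conjTranspose * (D τ)⁻¹)) = _ from
      Matrix.blockDiagonal_sub (fun τ => (D τ)⁻¹) fun τ => (D τ)⁻¹ * U τ *
      ((V τ).conjTranspose * (D τ)⁻¹ * U τ)⁻¹ * ((V τ).conjTranspose * (D τ)⁻¹)]
  have hE := Matrix.blockDiagonal_mul (fun τ => (D τ)⁻¹ * U τ)
    fun τ => ((V τ).conjTranspose * (D τ)⁻¹ * U τ)⁻¹
  rw [Matrix.blockDiagonal_mul (fun τ => (D τ)⁻¹) U] at hE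
  have hF := Matrix.blockDiagonal_mul (fun τ => ((V τ).conjTranspose * (D τ)⁻¹ * U τ)⁻¹)
    fun τ => (V τ).conjTranspose * (D τ)⁻¹
  have hWY := Matrix.blockDiagonal_mul (fun τ => (V τ).conjTranspose) fun τ => (D τ)⁻¹
  have hG := Matrix.blockDiagonal_mul
    (fun τ => (D τ)⁻¹ * U τ * ((V τ).conjTranspose * (D τ)⁻¹ * U τ)⁻¹)
    fun τ => (V τ).conjTranspose * (D τ)⁻¹
  rw [hE, hWY] at hG
  rw [hWY] at hF
  rw [hE, hF, hG]
  refine Matrix.compressed_inverse _ _ _ _ _ _ _ ?_ ?_ hX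
  · rw [← Matrix.blockDiagonal_mul]
    simp only [fun τ => Matrix.mul_nonsing_inv (D τ) ((Matrix.isUnit_iff_isUnit_det _).1 (h τ).1)]
    exact Matrix.blockDiagonal_one
  · rw [← hWY, ← Matrix.blockDiagonal_mul, ← Matrix.blockDiagonal_mul]
    simp only [fun τ => Matrix.mul_nonsing_inv _ ((Matrix.isUnit_iff_isUnit_det _).1 (h τ).2)]
    exact Matrix.blockDiagonal_one

/-- In the worst case `m = 2k`, the two inversions are bounded by `24k³ + 3k³`, the six products
cost `36k³`, and the adjoint and the subtraction cost `6k² ≤ 6k³`. -/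
theorem boxFactors_cost_le {m k : ℕ} (hm : m ≤ 2 * k) (D : Matrix (Fin m) (Fin m) 𝕜)
    (U V : Matrix (Fin m) (Fin k) 𝕜) : (boxFactors D U V).cost ≤ 69 * k ^ 3 := by
  simp only [boxFactors, Counted.cost_bind, Counted.cost_pure, matMul_cost, matAdjoint_cost,
    matSub_cost]
  have h₁ := gaussInv_cost_le D
  have h₂ := gaussInv_cost_le (matMul (matAdjoint V).val (matMul (gaussInv D).val U).val).val
  have h₃ : m ^ 3 ≤ (2 * k) ^ 3 := Nat.pow_le_pow_left hm 3
  have h₄ : m * m ≤ (2 * k) * (2 * k) := Nat.mul_le_mul hm hm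
  have h₅ := Nat.mul_le_mul_right k h₄
  have h₆ := Nat.mul_le_mul_right k hm
  have h₇ := Nat.mul_le_mul_right (k * k) hm
  have h₈ : k * k ≤ k ^ 3 := by
    rw [← pow_two]
    rcases Nat.eq_zero_or_pos k with rfl | hk
    · simp
    · exact Nat.pow_le_pow_right hk (by norm_num)
  ring_nf at *
  lia

end BoxFactors

/-! ### The telescoping factorization and exactness of the inverse -/

/-- The matrix with the diagonal blocks `Dhat τ` and the off-diagonal blocks `At τ τ'`. -/
def levelMatrix {𝕜 : Type} {k ℓ : ℕ} (Dhat : Box ℓ → Matrix (Fin k) (Fin k) 𝕜)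
    (At : Box ℓ → Box ℓ → Matrix (Fin k) (Fin k) 𝕜) :
    Matrix (Fin k × Box ℓ) (Fin k × Box ℓ) 𝕜 :=
  Matrix.of fun p q => if p.2 = q.2 then Dhat p.2 p.1 q.1 else At p.2 q.2 p.1 q.1

section LevelMatrix

variable {𝕜 : Type} [Field 𝕜] {k ℓ : ℕ} (Dhat : Box ℓ → Matrix (Fin k) (Fin k) 𝕜)
  (At : Box ℓ → Box ℓ → Matrix (Fin k) (Fin k) 𝕜)

/-- Subtracting `Dhat` clears the diagonal blocks, so `D` is all that remains there, and off the
diagonal only `At` contributes. -/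
theorem compressed_levelMatrix_apply {m : ℕ} (U : Box ℓ → Matrix (Fin m) (Fin k) 𝕜)
    (W : Box ℓ → Matrix (Fin k) (Fin m) 𝕜) (D : Box ℓ → Matrix (Fin m) (Fin m) 𝕜)
    (p q : Fin m × Box ℓ) :
    (Matrix.blockDiagonal U * (levelMatrix Dhat At - Matrix.blockDiagonal Dhat) *
        Matrix.blockDiagonal W + Matrix.blockDiagonal D) p q =
      if p.2 = q.2 then D p.2 p.1 q.1 else (U p.2 * At p.2 q.2 * W q.2) p.1 q.1 := by
  rw [Matrix.add_apply, Matrix.blockDiagonal_mul_mul_apply, Matrix.blockDiagonal_apply]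
  have hX : (levelMatrix Dhat At - Matrix.blockDiagonal Dhat).submatrix (fun i => (i, p.2))
      (fun j => (j, q.2)) = if p.2 = q.2 then 0 else At p.2 q.2 := by
    ext i j
    by_cases h : p.2 = q.2 <;> simp [levelMatrix, Matrix.blockDiagonal_apply, h]
  rw [hX]
  by_cases h : p.2 = q.2 <;> simp [h]

end LevelMatrix

namespace HBSFactors

variable {𝕜 : Type} {L n k : ℕ} (H : HBSFactors 𝕜 L n k)

/-- Two boxes with the same parent are equal or siblings, and these four cases are the four blocks
of `D̃`. -/
theorem levelMatrix_apply_of_parent_eq {ℓ : ℕ} {Dhat : Box (ℓ + 1) → Matrix (Fin k) (Fin k) 𝕜}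
    {At : Box (ℓ + 1) → Box (ℓ + 1) → Matrix (Fin k) (Fin k) 𝕜}
    (hB : ∀ τ : Box ℓ, H.B₁₂ ℓ τ = At (τ.child 0) (τ.child 1) ∧
      H.B₂₁ ℓ τ = At (τ.child 1) (τ.child 0))
    (p q : Fin k × Box (ℓ + 1)) (h : p.2.parent = q.2.parent) :
    levelMatrix Dhat At p q =
      H.assemble ℓ Dhat p.2.parent (reblock p).1 (reblock q).1 := by
  obtain ⟨i, τ, a⟩ := p
  obtain ⟨j, τ', b⟩ := q
  obtain rfl : τ = τ' := h
  rw [assemble, blockMatrix_reblock, (hB _).1, (hB _).2]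
  have h₀₁ : τ.child 0 ≠ τ.child 1 := fun h => zero_ne_one (congrArg Prod.snd h)
  fin_cases a <;> fin_cases b
  · exact if_pos rfl
  · exact if_neg h₀₁
  · exact if_neg h₀₁.symm
  · exact if_pos rfl

/-- One telescoping step. Pairs with a common parent form the blocks `D̃`; all others are governed
by the nested HBS condition. `Dhat'` is arbitrary because it cancels, and is later chosen to make
`Matrix.compressed_inverse` applicable. -/
theorem levelMatrix_succ [Field 𝕜] [StarRing 𝕜] {ℓ : ℕ}
    {Dhat : Box (ℓ + 1) → Matrix (Fin k) (Fin k) 𝕜}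
    {At : Box (ℓ + 1) → Box (ℓ + 1) → Matrix (Fin k) (Fin k) 𝕜}
    (hB : ∀ τ : Box ℓ, H.B₁₂ ℓ τ = At (τ.child 0) (τ.child 1) ∧
      H.B₂₁ ℓ τ = At (τ.child 1) (τ.child 0))
    (Dhat' : Box ℓ → Matrix (Fin k) (Fin k) 𝕜) (At' : Box ℓ → Box ℓ → Matrix (Fin k) (Fin k) 𝕜)
    (hAt : ∀ τ τ' : Box ℓ, τ ≠ τ' →
      blockMatrix (fun a b => At (τ.child a) (τ'.child b)) =
        H.U ℓ τ * At' τ τ' * (H.V ℓ τ').conjTranspose) :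
    levelMatrix Dhat At =
      (Matrix.blockDiagonal (H.U ℓ) * (levelMatrix Dhat' At' - Matrix.blockDiagonal Dhat') *
        (Matrix.blockDiagonal fun τ => (H.V ℓ τ).conjTranspose) +
          Matrix.blockDiagonal (H.assemble ℓ Dhat)).submatrix reblock reblock := by
  ext p q
  rw [Matrix.submatrix_apply, compressed_levelMatrix_apply]
  by_cases h : (reblock p).2 = (reblock q).2
  · rw [if_pos h, H.levelMatrix_apply_of_parent_eq hB p q h]
    rfl
  · rw [if_neg h, ← hAt _ _ h, blockMatrix_reblock, levelMatrix, Matrix.of_apply, if_neg]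
    · rfl
    · exact fun h' => h (congrArg Box.parent h')

/-- Both boxes on level 1 have the root as parent, so no HBS condition enters. -/
theorem levelMatrix_one [Field 𝕜] {Dhat : Box 1 → Matrix (Fin k) (Fin k) 𝕜}
    {At : Box 1 → Box 1 → Matrix (Fin k) (Fin k) 𝕜}
    (hB : ∀ τ : Box 0, H.B₁₂ 0 τ = At (τ.child 0) (τ.child 1) ∧
      H.B₂₁ 0 τ = At (τ.child 1) (τ.child 0)) :
    levelMatrix Dhat At =
      (Matrix.blockDiagonal fun _ : Box 0 => H.assemble 0 Dhat Box.root).submatrix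
        reblock reblock := by
  ext p q
  rw [Matrix.submatrix_apply, Matrix.blockDiagonal_apply, if_pos (show (reblock p).2 = (reblock q).2 from rfl)]
  exact H.levelMatrix_apply_of_parent_eq hB p q rfl

variable [Field 𝕜] [StarRing 𝕜] [DecidableEq 𝕜]

/-- Induction from the root. `Dhat` has to be arbitrary, because each step hands the newly computed
diagonal blocks to the coarser level. -/
theorem levelMatrix_mul_invertUpper
    (At : (ℓ : ℕ) → Box ℓ → Box ℓ → Matrix (Fin k) (Fin k) 𝕜)
    (hAt : ∀ ℓ : ℕ, 1 ≤ ℓ → ℓ ≤ L → ∀ τ τ' : Box ℓ, τ ≠ τ' →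
      blockMatrix (fun a b => At (ℓ + 1) (τ.child a) (τ'.child b)) =
        H.U ℓ τ * At ℓ τ τ' * (H.V ℓ τ').conjTranspose)
    (hB : ∀ ℓ : ℕ, ℓ ≤ L → ∀ τ : Box ℓ,
      H.B₁₂ ℓ τ = At (ℓ + 1) (τ.child 0) (τ.child 1) ∧
      H.B₂₁ ℓ τ = At (ℓ + 1) (τ.child 1) (τ.child 0))
    (ℓ : ℕ) (hℓ : ℓ ≤ L) (Dhat : Box (ℓ + 1) → Matrix (Fin k) (Fin k) 𝕜)
    (hH : H.UpperNonsingular ℓ Dhat) :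
    levelMatrix Dhat (At (ℓ + 1)) * (invertUpper H ℓ Dhat).val.toMatrix = 1 := by
  induction ℓ with
  | zero =>
    rw [H.levelMatrix_one (hB 0 hℓ)]
    simp only [invertUpper, Counted.val_bind, Counted.val_pure, UpperInverse.toMatrix]
    rw [gaussInv_val _ hH, show (reblock : Fin k × Box (0 + 1) → _) = reblockEquiv 0 from rfl,
      Matrix.submatrix_mul_equiv, ← Matrix.blockDiagonal_mul,
      Matrix.mul_nonsing_inv _ ((Matrix.isUnit_iff_isUnit_det _).1 hH)]
    rw [show (fun _ : Box 0 => (1 : Matrix (Fin (2 * k)) (Fin (2 * k)) 𝕜)) = 1 from rfl,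
      Matrix.blockDiagonal_one, Matrix.submatrix_one_equiv]
  | succ ℓ ih =>
    obtain ⟨h₁, h₂⟩ := hH
    have hX := ih (Nat.le_of_succ_le hℓ) _ h₂
    have hf := fun τ : Box (ℓ + 1) => boxFactors_val _ _ _ (h₁ τ).1 (h₁ τ).2
    rw [H.levelMatrix_succ (hB _ hℓ) (fun τ : Box (ℓ + 1) => ((H.V (ℓ + 1) τ).conjTranspose *
      (H.assemble (ℓ + 1) Dhat τ)⁻¹ * H.U (ℓ + 1) τ)⁻¹) _ (hAt _ (by lia) hℓ)]
    simp only [invertUpper, Counted.val_bind, Counted.val_pure, Counted.val_forAll,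
      UpperInverse.toMatrix]
    rw [show (reblock : Fin k × Box (ℓ + 1 + 1) → _) = reblockEquiv (ℓ + 1) from rfl,
      Matrix.submatrix_mul_equiv]
    have hDhat : (fun τ => (boxFactors (H.assemble (ℓ + 1) Dhat τ) (H.U (ℓ + 1) τ)
        (H.V (ℓ + 1) τ)).val.Dhat) = fun τ : Box (ℓ + 1) => ((H.V (ℓ + 1) τ).conjTranspose *
      (H.assemble (ℓ + 1) Dhat τ)⁻¹ * H.U (ℓ + 1) τ)⁻¹ := by
      simp only [hf]
    rw [hDhat, boxFactors_compressed_inverse _ _ _ h₁ _ _ hX, Matrix.submatrix_one_equiv]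

theorem invertHBS_toMatrix {N : ℕ} (I : Fin n × Box (L + 1) ≃ Fin N)
    (A : Matrix (Fin N) (Fin N) 𝕜) (hA : H.Represents I A) (hH : H.Nonsingular) :
    (invertHBS H).val.toMatrix I = A⁻¹ := by
  obtain ⟨At, hleaf, hAt, hD, hB⟩ := hA
  obtain ⟨h₁, h₂⟩ := hH
  have hX := H.levelMatrix_mul_invertUpper At hAt hB L le_rfl _ h₂
  have hf := fun τ : Box (L + 1) => boxFactors_val _ _ _ (h₁ τ).1 (h₁ τ).2
  have hDhat : (fun τ => (boxFactors (H.D τ) (H.Uleaf τ) (H.Vleaf τ)).val.Dhat) =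
      fun τ => ((H.Vleaf τ).conjTranspose * (H.D τ)⁻¹ * H.Uleaf τ)⁻¹ := by
    simp only [hf]
  have hinv := boxFactors_compressed_inverse _ _ _ h₁ _ _ hX
  have hAI : Matrix.blockDiagonal H.Uleaf *
        (levelMatrix (fun τ => ((H.Vleaf τ).conjTranspose * (H.D τ)⁻¹ * H.Uleaf τ)⁻¹)
          (At (L + 1)) - Matrix.blockDiagonal fun τ =>
            ((H.Vleaf τ).conjTranspose * (H.D τ)⁻¹ * H.Uleaf τ)⁻¹) *
        (Matrix.blockDiagonal fun τ => (H.Vleaf τ).conjTranspose) + Matrix.blockDiagonal H.D =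
      A.submatrix I I := by
    ext p q
    rw [compressed_levelMatrix_apply]
    by_cases h : p.2 = q.2
    · rw [if_pos h, hD]
      nth_rewrite 2 [h]
      rfl
    · rw [if_neg h, ← hleaf _ _ h]
      rfl
  rw [hAI] at hinv
  symm
  apply Matrix.inv_eq_right_inv
  simp only [invertHBS, Counted.val_bind, Counted.val_pure, Counted.val_forAll,
    InverseFactors.toMatrix]
  rw [hDhat]
  -- Both factors become reindexings along `I.symm`, so the product can be formed in the ordering by
  -- leaves.
  have hA' : A = (A.submatrix I I).submatrix I.symm I.symm := by simp
  nth_rewrite 1 [hA']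
  rw [Matrix.submatrix_mul_equiv, hinv, Matrix.submatrix_one_equiv]

end HBSFactors

/-! ### Correctness of the application algorithm -/

section Apply

variable {𝕜 : Type} [Field 𝕜]

/-- The two passes evaluate `E (S (F^* v)) + G v` from the inside out, where `S` is the matrix of
the coarser levels. -/
theorem applyUpper_val {k ℓ : ℕ} (R : UpperInverse 𝕜 k ℓ) (v : Box (ℓ + 1) → Fin k → 𝕜)
    (p : Fin k × Box (ℓ + 1)) :
    (applyUpper R v).val p.2 p.1 = R.toMatrix.mulVec (fun q => v q.2 q.1) p := by
  induction R with
  | root G =>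
    rw [UpperInverse.toMatrix, show (reblock : Fin k × Box (0 + 1) → _) = reblockEquiv 0 from rfl,
      Matrix.submatrix_mulVec_equiv, Function.comp_apply, Matrix.blockDiagonal_mulVec]
    simp only [applyUpper, Counted.val_bind, Counted.val_pure, matVec_val]
    rfl
  | @level ℓ E F G R ih =>
    rw [UpperInverse.toMatrix, show (reblock : Fin k × Box (ℓ + 1 + 1) → _) =
      reblockEquiv (ℓ + 1) from rfl, Matrix.submatrix_mulVec_equiv, Function.comp_apply,
      Matrix.add_mulVec, Pi.add_apply, ← Matrix.mulVec_mulVec, ← Matrix.mulVec_mulVec,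
      Matrix.blockDiagonal_mulVec, Matrix.blockDiagonal_mulVec]
    simp only [applyUpper, Counted.val_bind, Counted.val_pure, matVec_val, Counted.val_forAll,
      vecAdd_val]
    rw [show Matrix.mulVec (Matrix.blockDiagonal F) _ = fun q : Fin k × Box (ℓ + 1) => _ from
      funext fun q => Matrix.blockDiagonal_mulVec F _ q]
    simp only [show ∀ v, (applyUpper R v).val =
      fun τ j => R.toMatrix.mulVec (fun q => v q.2 q.1) (j, τ) from
      fun v => funext fun τ => funext fun j => ih v (j, τ)]
    rfl

theorem applyInverse_val {L n k N : ℕ} (R : InverseFactors 𝕜 L n k)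
    (I : Fin n × Box (L + 1) ≃ Fin N) (u : Fin N → 𝕜) :
    (applyInverse R I u).val = (R.toMatrix I).mulVec u := by
  ext s
  rw [InverseFactors.toMatrix, Matrix.submatrix_mulVec_equiv, Function.comp_apply,
    Matrix.add_mulVec, Pi.add_apply, ← Matrix.mulVec_mulVec, ← Matrix.mulVec_mulVec,
    Matrix.blockDiagonal_mulVec, Matrix.blockDiagonal_mulVec]
  simp only [applyInverse, Counted.val_bind, Counted.val_pure, matVec_val, Counted.val_forAll,
    vecAdd_val]
  rw [show Matrix.mulVec (Matrix.blockDiagonal R.Fadj) _ = fun q : Fin k × Box (L + 1) => _ from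
    funext fun q => Matrix.blockDiagonal_mulVec R.Fadj _ q]
  simp only [show ∀ v, (applyUpper R.coarser v).val =
    fun τ j => R.coarser.toMatrix.mulVec (fun q => v q.2 q.1) (j, τ) from
    fun v => funext fun τ => funext fun j => applyUpper_val R.coarser v (j, τ)]
  rfl

end Apply

/-! ### Operation counts and storage -/

section Cost

variable {𝕜 : Type} [Field 𝕜]

theorem Box.cost_forAll_le {ℓ : ℕ} {α : Type} (f : Box ℓ → Counted α) (c : ℕ)
    (h : ∀ τ, (f τ).cost ≤ c) : (forAll f).cost ≤ 2 ^ ℓ * c := by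
  simpa [Box.card] using Counted.cost_forAll_le f c h

/-- Geometric sum: the level `ℓ + 1` costs at most as much as the bound for all coarser levels, so
the bound doubles exactly. -/
theorem invertUpper_cost_le [StarRing 𝕜] [DecidableEq 𝕜] {L n k : ℕ} (H : HBSFactors 𝕜 L n k)
    (ℓ : ℕ) (Dhat : Box (ℓ + 1) → Matrix (Fin k) (Fin k) 𝕜) :
    (invertUpper H ℓ Dhat).cost ≤ 69 * (2 ^ (ℓ + 1) * k ^ 3) := by
  induction ℓ with
  | zero =>
    simp only [invertUpper, Counted.cost_bind, Counted.cost_pure]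
    have := gaussInv_cost_le (H.assemble 0 Dhat Box.root)
    rw [mul_pow] at this
    lia
  | succ ℓ ih =>
    simp only [invertUpper, Counted.cost_bind, Counted.cost_pure]
    have h₁ := Box.cost_forAll_le (fun τ : Box (ℓ + 1) =>
      boxFactors (H.assemble (ℓ + 1) Dhat τ) (H.U (ℓ + 1) τ) (H.V (ℓ + 1) τ)) (69 * k ^ 3)
      fun τ => boxFactors_cost_le le_rfl _ _ _
    refine (add_le_add h₁ (add_le_add_left (ih _) 0)).trans (le_of_eq ?_)
    ring

theorem invertHBS_cost_le [StarRing 𝕜] [DecidableEq 𝕜] {L n k : ℕ} (hn : n ≤ 2 * k)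
    (H : HBSFactors 𝕜 L n k) : (invertHBS H).cost ≤ 138 * (2 ^ (L + 1) * k ^ 3) := by
  simp only [invertHBS, Counted.cost_bind, Counted.cost_pure]
  have h₁ := Box.cost_forAll_le (fun τ : Box (L + 1) =>
    boxFactors (H.D τ) (H.Uleaf τ) (H.Vleaf τ)) (69 * k ^ 3)
    fun τ => boxFactors_cost_le hn _ _ _
  refine (add_le_add h₁ (add_le_add_left (invertUpper_cost_le H L _) 0)).trans (le_of_eq ?_)
  ring

theorem UpperInverse.storage_le {𝕜 : Type} {k ℓ : ℕ} (R : UpperInverse 𝕜 k ℓ) :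
    R.storage ≤ 8 * (2 ^ (ℓ + 1) * k ^ 2) := by
  induction R with
  | root G =>
    rw [storage]
    ring_nf
    lia
  | level E F G R ih =>
    rw [storage]
    refine (add_le_add_right ih _).trans (le_of_eq ?_)
    ring

theorem InverseFactors.storage_le {𝕜 : Type} {L n k : ℕ} (hn : n ≤ 2 * k) (R : InverseFactors 𝕜 L n k) :
    R.storage ≤ 16 * (2 ^ (L + 1) * k ^ 2) := by
  rw [storage]
  -- `2k² + 2k² + 4k²` in the worst case `n = 2k`, the same as for a parent box.
  have h : n * k + k * n + n * n ≤ 8 * k ^ 2 := by nlinarith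
  refine (add_le_add (Nat.mul_le_mul_left _ h) R.coarser.storage_le).trans (le_of_eq ?_)
  ring

/-- The summands are the costs for one box of the products with `F^*`, `E`, `G` and of the vector
addition; at `m = 2k` they are `4k² + 4k² + 8k² + 2k`. -/
theorem applyBox_cost_le {m k : ℕ} (hm : m ≤ 2 * k) :
    k * (2 * m) + (m * (2 * k) + (m * (2 * m) + m)) ≤ 18 * k ^ 2 := by
  have h₁ : k ≤ k * k := Nat.le_mul_self k
  nlinarith

theorem applyUpper_cost_le {k ℓ : ℕ} (R : UpperInverse 𝕜 k ℓ) (v : Box (ℓ + 1) → Fin k → 𝕜) :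
    (applyUpper R v).cost ≤ 18 * (2 ^ (ℓ + 1) * k ^ 2) := by
  induction R with
  | root G =>
    simp only [applyUpper, Counted.cost_bind, Counted.cost_pure, matVec_cost]
    ring_nf
    lia
  | @level ℓ E F G R ih =>
    simp only [applyUpper, Counted.cost_bind, Counted.cost_pure, Counted.cost_forAll, matVec_cost,
      vecAdd_cost, Finset.sum_const, Finset.card_univ, Box.card, smul_eq_mul]
    have h₁ := Nat.mul_le_mul_left (2 ^ (ℓ + 1)) (applyBox_cost_le (le_refl (2 * k)))
    have h₂ := ih (Counted.val (forAll fun τ : Box (ℓ + 1) =>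
      matVec (F τ) (stack fun a => v (τ.child a))))
    rw [pow_succ 2 (ℓ + 1)]
    rw [mul_add] at h₁
    lia

theorem applyInverse_cost_le {L n k N : ℕ} (hn : n ≤ 2 * k) (R : InverseFactors 𝕜 L n k)
    (I : Fin n × Box (L + 1) ≃ Fin N) (u : Fin N → 𝕜) :
    (applyInverse R I u).cost ≤ 36 * (2 ^ (L + 1) * k ^ 2) := by
  simp only [applyInverse, Counted.cost_bind, Counted.cost_pure, Counted.cost_forAll, matVec_cost,
    vecAdd_cost, Finset.sum_const, Finset.card_univ, Box.card, smul_eq_mul]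
  have h₁ := Nat.mul_le_mul_left (2 ^ (L + 1)) (applyBox_cost_le hn)
  have h₂ := applyUpper_cost_le R.coarser (Counted.val (forAll fun τ : Box (L + 1) =>
      matVec (R.Fadj τ) fun i => u (I (i, τ))))
  rw [mul_add] at h₁
  lia

end Cost

/-! ### From powers of the block rank to `N`, and the theorem -/

/-- The invertible `k × k` matrix `V^* D⁻¹ U` of any leaf has rank `k`, but at most the rank of `U`,
which has `n` rows. -/
theorem HBSFactors.Nonsingular.rank_le {𝕜 : Type} [Field 𝕜] [StarRing 𝕜] {L n k : ℕ}
    {H : HBSFactors 𝕜 L n k} (hH : H.Nonsingular) : k ≤ n := by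
  have : Nonempty (Box (L + 1)) := Fintype.card_pos_iff.1 (by simp [Box.card])
  obtain ⟨τ⟩ := this
  have h := Matrix.rank_of_isUnit _ (hH.1 τ).2
  rw [Fintype.card_fin] at h
  rw [← h]
  exact (Matrix.rank_mul_le_right _ _).trans (Matrix.rank_le_height _)

theorem theorem1 :
    ∃ C : ℕ, ∀ (𝕜 : Type) [RCLike 𝕜] [DecidableEq 𝕜] (L n k N : ℕ)
      (I : Fin n × Box (L + 1) ≃ Fin N) (A : Matrix (Fin N) (Fin N) 𝕜) (H : HBSFactors 𝕜 L n k),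
      N = n * 2 ^ (L + 1) → n ≤ 2 * k → H.Represents I A → IsUnit A → H.Nonsingular →
        (invertHBS H).val.toMatrix I = A⁻¹ ∧
        (invertHBS H).cost ≤ C * (N * k ^ 2) ∧
        (invertHBS H).val.storage ≤ C * (N * k) ∧
        ∀ u : Fin N → 𝕜,
          (applyInverse (invertHBS H).val I u).val = A⁻¹.mulVec u ∧
          (applyInverse (invertHBS H).val I u).cost ≤ C * (N * k) := by
  -- The largest of the constants 138 (inversion), 16 (storage) and 36 (application).
  refine ⟨138, fun 𝕜 _ _ L n k N I A H hN hn hA _ hH => ?_⟩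
  have hk := hH.rank_le
  have hNk : 2 ^ (L + 1) * k ^ 2 ≤ N * k := by
    rw [hN, pow_two, mul_comm n, mul_assoc]
    exact Nat.mul_le_mul_left _ (Nat.mul_le_mul_right _ hk)
  have hNk₂ : 2 ^ (L + 1) * k ^ 3 ≤ N * k ^ 2 := by
    calc 2 ^ (L + 1) * k ^ 3 = 2 ^ (L + 1) * k ^ 2 * k := by ring
      _ ≤ N * k * k := Nat.mul_le_mul_right _ hNk
      _ = N * k ^ 2 := by ring
  have hinv := H.invertHBS_toMatrix I A hA hH
  have hcost := invertHBS_cost_le hn H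
  have hstorage := (invertHBS H).val.storage_le hn
  refine ⟨hinv, by lia, by lia, fun u => ⟨?_, ?_⟩⟩
  · rw [applyInverse_val, hinv]
  · have := applyInverse_cost_le hn (invertHBS H).val I u
    lia
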